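/- Let $X$ be a real Banach space with topological dual $X^*$, let $f_1,\dots,f_m,g_1,\dots,g_l\colon X\to\mathbb{R}$ ($m,l\ge 0$), let $$M=\{x\in X \mid f_i(x)=0,\ i\in I,\ g_j(x)\le 0,\ j\in J\},\qquad I=\{1,\dots,m\},\ J=\{1,\dots,l\},$$ let $\overline{x}\in M$, and put $J(\overline{x})=\{j\in J\mid g_j(\overline{x})=0\}$. Definitions. A function $f\colon X\to\mathbb{R}$ is directionally differentiable (d.d.) at $x$ if for every $v\in X$ the finite limit $f'(x,v)=\lim_{\alpha\to+0}\frac{f(x+\alpha v)-f(x)}{\alpha}$ exists. It is d.d. at $x$ uniformly along finite dimensional spaces if, in addition, for every $v\in X$ and every finite dimensional subspace $X_0\subset X$ the quotient $\frac{f(x+\alpha v')-f(x)}{\alpha}$ tends to $f'(x,v)$ as $\alpha\to+0$, $v'\to v$, $v'\in v+X_0$. It is Hadamard d.d. at $x$ if for every $v\in X$ the quotient $\frac{f(x+\alpha v')-f(x)}{\alpha}$ has a finite limit as $\alpha\to+0$ and $v'\to v$ in $X$. It is quasidifferentiable at $x$, with quasidifferential $[\underline{\partial}f(x),\overline{\partial}f(x)]$,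 if it is d.d. at $x$ and $\underline{\partial}f(x),\overline{\partial}f(x)\subset X^*$ are (nonempty) convex weak$^*$ compact sets with $$f'(x,v)=\max_{x^*\in\underline{\partial}f(x)}\langle x^*,v\rangle+\min_{y^*\in\overline{\partial}f(x)}\langle y^*,v\rangle\qquad\forall v\in X.$$ The quasidifferential sum is $[\mathscr{D}f(x)]^+=\underline{\partial}f(x)+\overline{\partial}f(x)$. The contingent cone $T_M(\overline{x})$ consists of all $v\in X$ for which there are $\alpha_n>0$, $\alpha_n\to 0$, and $v_n\to v$ with $\overline{x}+\alpha_n v_n\in M$ for all $n$. Finally, $\mathrm{cl}^*$ denotes the weak$^*$ closure, $\mathrm{co}$ the convex hull, and $\mathrm{span}$ the linear span (with $\mathrm{co}\,\emptyset=\emptyset$ and $\mathrm{span}\,\emptyset=\{0\}$). Assume that every $f_i$, $i\in I$, is continuous in a neighbourhood of $\overline{x}$, that every $g_j$, $j\notin J(\overline{x})$, is upper semicontinuous at $\overline{x}$, and that every $f_i$, $i\in I$, and every $g_j$, $j\in J(\overline{x})$, is quasidifferentiable at $\overline{x}$, with a given quasidifferential there, and d.d. at $\overline{x}$ uniformly along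 finite dimensional spaces. Suppose also that $$[\mathscr{D}f_i(\overline{x})]^+\cap\mathrm{cl}^*\,\mathrm{span}\{[\mathscr{D}f_k(\overline{x})]^+\mid k\ne i\}=\emptyset\qquad\forall i\in I,$$ $$\mathrm{co}\{[\mathscr{D}g_j(\overline{x})]^+\mid j\in J(\overline{x})\}\cap\mathrm{cl}^*\,\mathrm{span}\{[\mathscr{D}f_i(\overline{x})]^+\mid i\in I\}=\emptyset.$$ Then $$\{v\in X\mid f_i'(\overline{x},v)=0,\ i\in I,\ g_j'(\overline{x},v)\le 0,\ j\in J(\overline{x})\}\subseteq T_M(\overline{x}).$$ If, moreover, the functions $f_i$, $i\in I$, and $g_j$, $j\in J(\overline{x})$, are Hadamard d.d. at $\overline{x}$, then the opposite inclusion also holds, so that the two sets are equal. Each of the functions $f_i$, $i\in I$, and $g_j$, $j\in J(\overline{x})$, that is Lipschitz continuous near $\overline{x}$ is Hadamard d.d. at $\overline{x}$; in particular, the two sets are equal if all these functions are Lipschitz continuous near $\overline{x}$. -/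

import Mathlib

open Set Filter Topology
open scoped Pointwise

noncomputable section

namespace Quasidiff

variable {X : Type*} [NormedAddCommGroup X] [NormedSpace ℝ X]

/-- `f` is directionally differentiable at `x`: for every `v` the difference quotient
`(f (x + α v) - f x) / α` has a finite limit as `α → +0`. -/
def IsDirDiffAt (f : X → ℝ) (x : X) : Prop :=
  ∀ v : X, ∃ d : ℝ, Tendsto (fun α : ℝ => (f (x + α • v) - f x) / α) (𝓝[>] 0) (𝓝 d)

/-- The directional derivative `f'(x, v)`, the limit of `(f (x + α v) - f x) / α` as `α → +0`
(meaningful when that limit exists). -/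
def dirDeriv (f : X → ℝ) (x v : X) : ℝ :=
  limUnder (𝓝[>] (0 : ℝ)) (fun α : ℝ => (f (x + α • v) - f x) / α)

/-- `f` is directionally differentiable at `x` uniformly along finite dimensional spaces: for every
`v` and every finite dimensional subspace `X₀`, the quotient `(f (x + α v') - f x) / α` tends to
`f'(x, v)` as `α → +0` and `v' → v` with `v' ∈ v + X₀`. -/
def IsDirDiffAtUnifFinDim (f : X → ℝ) (x : X) : Prop :=
  IsDirDiffAt f x ∧
    ∀ (v : X) (X₀ : Submodule ℝ X), FiniteDimensional ℝ X₀ →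
      Tendsto (fun p : ℝ × X => (f (x + p.1 • p.2) - f x) / p.1)
        (𝓝[>] (0 : ℝ) ×ˢ 𝓝[{v' : X | v' - v ∈ X₀}] v) (𝓝 (dirDeriv f x v))

/-- `f` is Hadamard directionally differentiable at `x`: for every `v` the quotient
`(f (x + α v') - f x) / α` has a finite limit as `α → +0` and `v' → v`. -/
def IsHadamardDirDiffAt (f : X → ℝ) (x : X) : Prop :=
  ∀ v : X, ∃ d : ℝ, Tendsto (fun p : ℝ × X => (f (x + p.1 • p.2) - f x) / p.1)
    (𝓝[>] (0 : ℝ) ×ˢ 𝓝 v) (𝓝 d)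

/-- The pair `[A, B]` of convex weak* compact sets of functionals is a quasidifferential of `f`
at `x`: `f` is directionally differentiable at `x` and
`f'(x, v) = max_{a ∈ A} ⟨a, v⟩ + min_{b ∈ B} ⟨b, v⟩` for all `v`, the maximum and the minimum being
attained (so that `A` and `B` are nonempty). -/
structure IsQuasidifferentialAt (f : X → ℝ) (x : X) (A B : Set (WeakDual ℝ X)) : Prop where
  isDirDiffAt : IsDirDiffAt f x
  convex_sub : Convex ℝ A
  isCompact_sub : IsCompact A
  convex_super : Convex ℝ B
  isCompact_super : IsCompact B
  dirDeriv_eq : ∀ v : X, ∃ s t : ℝ,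
    IsGreatest ((fun a : WeakDual ℝ X => a v) '' A) s ∧
    IsLeast ((fun b : WeakDual ℝ X => b v) '' B) t ∧
    dirDeriv f x v = s + t

/-- The quasidifferential sum `[𝒟 f(x)]⁺ = A + B` of a quasidifferential `[A, B]`. -/
def quasidiffSum (A B : Set (WeakDual ℝ X)) : Set (WeakDual ℝ X) := A + B

/-- The contingent cone to `M` at `x`: all `v` for which there are `α_n > 0`, `α_n → 0`, and
`v_n → v` with `x + α_n v_n ∈ M` for all `n`. -/
def contingentCone (M : Set X) (x : X) : Set X :=
  {v | ∃ (α : ℕ → ℝ) (u : ℕ → X), (∀ n, 0 < α n) ∧ Tendsto α atTop (𝓝 0) ∧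
    Tendsto u atTop (𝓝 v) ∧ ∀ n, x + α n • u n ∈ M}

/-- The set given by the constraints `f i = 0` for all `i` and `g j ≤ 0` for all `j`. -/
def constraintSet {m l : ℕ} (f : Fin m → X → ℝ) (g : Fin l → X → ℝ) : Set X :=
  {x | (∀ i, f i x = 0) ∧ ∀ j, g j x ≤ 0}

/-- The indices of the inequality constraints that are active at `x`. -/
def activeSet {l : ℕ} (g : Fin l → X → ℝ) (x : X) : Set (Fin l) := {j | g j x = 0}

/-- The set of all `v` with `f_i'(x, v) = 0` for all `i` and `g_j'(x, v) ≤ 0` for all active `j`. -/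
def linearizedSet {m l : ℕ} (f : Fin m → X → ℝ) (g : Fin l → X → ℝ) (x : X) : Set X :=
  {v | (∀ i, dirDeriv (f i) x v = 0) ∧ ∀ j ∈ activeSet g x, dirDeriv (g j) x v ≤ 0}

/-- `f` is Lipschitz continuous near `x`. -/
def IsLipschitzNear (f : X → ℝ) (x : X) : Prop :=
  ∃ K : NNReal, ∃ U ∈ 𝓝 x, LipschitzOnWith K f U

end Quasidiff

end

/-! The inclusion of the contingent cone under Hadamard differentiability and the Lipschitz claim
are limits of difference quotients; the substance is `linearizedSet_subset_contingentCone`. Weak*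
separation turns the two disjointness conditions into vectors: `V i`, on which the i-th equality sum
is positive while the other equality sums vanish, and `d`, on which the active inequality sums are
positive while all equality sums vanish. Since increments of a directional derivative are controlled
by functionals of the quasidifferential sum (`IsQuasidifferentialAt.exists_dirDeriv_add_le`),
passing from `v` to `w = v - δ d` keeps the equality derivatives at zero and makes the active
inequality derivatives negative, and adding `∑ k, t k • V k` gives the i-th equality derivative the
sign of `t i`.

For small `α` the difference quotients, as functions of `t`, keep these signs on the faces of a
small cube. The `f i` are merely continuous, so a common zero comes from `poincare_miranda`; it is a
feasible point `x + α • u` with `u` close to `w`.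

Poincaré–Miranda itself rests on a mod 2 count over the Kuhn triangulation: altering 0-cochains on a
finite set changes the cup product of their coboundaries by a total of zero (`finsum_kuhnCup_sub`),
and for the coordinate half-spaces exactly one simplex counts. -/

namespace Quasidiff

/-! ### Mod 2 cup products on the Kuhn triangulation -/

/-- The `k`-th vertex of the Kuhn simplex based at `S.1`, where `S.2 i` is the step at which the
`i`-th coordinate is raised. -/
def kuhnVertex {m : ℕ} (S : (Fin m → ℤ) × Equiv.Perm (Fin m)) (k : ℕ) : Fin m → ℤ :=
  fun i => S.1 i + if (S.2 i : ℕ) < k then 1 else 0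

/-- The product of the values of `φ j` at the vertex `j + 1` (for `j ∈ t`) or `j` (for `j ∉ t`). -/
def kuhnMonomial {m : ℕ} (φ : Fin m → (Fin m → ℤ) → ZMod 2) (t : Finset (Fin m))
    (S : (Fin m → ℤ) × Equiv.Perm (Fin m)) : ZMod 2 :=
  ∏ j, φ j (kuhnVertex S (if j ∈ t then (j : ℕ) + 1 else j))

/-- The cup product of the coboundaries of the `φ j`, evaluated on a Kuhn simplex. -/
def kuhnCup {m : ℕ} (φ : Fin m → (Fin m → ℤ) → ZMod 2)
    (S : (Fin m → ℤ) × Equiv.Perm (Fin m)) : ZMod 2 :=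
  ∏ j, (φ j (kuhnVertex S ((j : ℕ) + 1)) + φ j (kuhnVertex S j))

theorem kuhnCup_eq_sum {m : ℕ} (φ : Fin m → (Fin m → ℤ) → ZMod 2)
    (S : (Fin m → ℤ) × Equiv.Perm (Fin m)) :
    kuhnCup φ S = ∑ t : Finset (Fin m), kuhnMonomial φ t S := by
  classical
  unfold kuhnCup kuhnMonomial
  rw [Finset.prod_add, Finset.powerset_univ]
  refine Finset.sum_congr rfl fun t _ => ?_
  rw [← Finset.prod_mul_prod_compl t, Finset.compl_eq_univ_sdiff]
  congr 1
  · exact Finset.prod_congr rfl fun j hj => by simp [hj]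
  · exact Finset.prod_congr rfl fun j hj => by simp [(Finset.mem_sdiff.1 hj).2]

theorem finsum_eq_zero_of_involution {α : Type*} (G : α → ZMod 2) (hG : G.support.Finite)
    (e : α → α) (he : ∀ a, e (e a) = a) (hne : ∀ a, e a ≠ a) (hGe : ∀ a, G (e a) = G a) :
    ∑ᶠ a, G a = 0 := by
  rw [finsum_eq_sum G hG]
  refine Finset.sum_involution (fun a _ => e a) ?_ ?_ ?_ ?_
  · intro a _
    rw [hGe]
    exact CharTwo.add_self_eq_zero _
  · intro a _ _
    exact hne a
  · intro a ha
    simpa [hGe] using ha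
  · intro a _
    exact he a

/-- Exchange of the steps `a` and `b`. -/
def kuhnSwap {m : ℕ} (a b : Fin m) (S : (Fin m → ℤ) × Equiv.Perm (Fin m)) :
    (Fin m → ℤ) × Equiv.Perm (Fin m) :=
  (S.1, S.2.trans (Equiv.swap a b))

/-- Exchange of the first and the last step, the first step being done and the last one undone. -/
def kuhnEndSwap {m : ℕ} (a b : Fin m) (S : (Fin m → ℤ) × Equiv.Perm (Fin m)) :
    (Fin m → ℤ) × Equiv.Perm (Fin m) :=
  (fun i => S.1 i + ((if S.2 i = a then 1 else 0) - if S.2 i = b then 1 else 0),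
    S.2.trans (Equiv.swap a b))

theorem kuhnSwap_snd_ne {m : ℕ} {a b : Fin m} (hab : a ≠ b) (π : Equiv.Perm (Fin m)) :
    π.trans (Equiv.swap a b) ≠ π := by
  intro h
  have := congrArg (fun σ : Equiv.Perm (Fin m) => σ (π.symm a)) h
  simp at this
  exact hab this.symm

theorem kuhnVertex_kuhnSwap {m : ℕ} {a b : Fin m} (hab : (b : ℕ) = a + 1)
    (S : (Fin m → ℤ) × Equiv.Perm (Fin m)) {k : ℕ} (hk : k ≠ b) :
    kuhnVertex (kuhnSwap a b S) k = kuhnVertex S k := by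
  funext i
  simp only [kuhnVertex, kuhnSwap, Equiv.trans_apply, Equiv.swap_apply_def]
  split_ifs <;> simp_all <;> omega

theorem kuhnVertex_kuhnEndSwap {m : ℕ} {a b : Fin m} (ha : (a : ℕ) = 0) (hb : (b : ℕ) + 1 = m)
    (S : (Fin m → ℤ) × Equiv.Perm (Fin m)) {k : ℕ} (hk : 0 < k) (hkm : k < m) :
    kuhnVertex (kuhnEndSwap a b S) k = kuhnVertex S k := by
  funext i
  simp only [kuhnVertex, kuhnEndSwap, Equiv.trans_apply, Equiv.swap_apply_def]
  split_ifs <;> simp_all <;> omega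

theorem kuhnEndSwap_kuhnEndSwap {m : ℕ} {a b : Fin m} (hab : a ≠ b)
    (S : (Fin m → ℤ) × Equiv.Perm (Fin m)) : kuhnEndSwap a b (kuhnEndSwap a b S) = S := by
  refine Prod.ext ?_ ?_
  · funext i
    simp only [kuhnEndSwap, Equiv.trans_apply, Equiv.swap_apply_def]
    split_ifs <;> simp_all
  · ext i
    simp [kuhnEndSwap]

/-- The step of the first vertex to the end of the simplex. -/
def kuhnRotate {n : ℕ} :
    ((Fin (n + 1) → ℤ) × Equiv.Perm (Fin (n + 1))) ≃
      ((Fin (n + 1) → ℤ) × Equiv.Perm (Fin (n + 1))) where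
  toFun S := (fun i => S.1 i + if S.2 i = 0 then 1 else 0, S.2.trans (finRotate (n + 1)).symm)
  invFun S := (fun i => S.1 i - if S.2 i = Fin.last n then 1 else 0,
    S.2.trans (finRotate (n + 1)))
  left_inv S := by
    refine Prod.ext ?_ ?_
    · funext i
      have : (finRotate (n + 1)).symm (S.2 i) = Fin.last n ↔ S.2 i = 0 := by
        rw [Equiv.symm_apply_eq, finRotate_last]
      simp only [Equiv.trans_apply, this, add_sub_cancel_right]
    · ext i
      simp
  right_inv S := by
    refine Prod.ext ?_ ?_
    · funext i
      have : finRotate (n + 1) (S.2 i) = 0 ↔ S.2 i = Fin.last n := by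
        rw [← finRotate_last, Equiv.apply_eq_iff_eq]
      simp only [Equiv.trans_apply, this, sub_add_cancel]
    · ext i
      simp

theorem kuhnVertex_kuhnRotate {n : ℕ} (S : (Fin (n + 1) → ℤ) × Equiv.Perm (Fin (n + 1)))
    {k : ℕ} (hk : k < n + 1) : kuhnVertex (kuhnRotate S) k = kuhnVertex S (k + 1) := by
  funext i
  obtain ⟨p, hp⟩ := (finRotate (n + 1)).surjective (S.2 i)
  have h2 : (kuhnRotate S).2 i = p := by
    rw [← Equiv.symm_apply_apply (finRotate (n + 1)) p, hp]
    rfl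
  have h1 : (kuhnRotate S).1 i = S.1 i + if S.2 i = 0 then 1 else 0 := rfl
  have h3 := coe_finRotate p
  rw [hp] at h3
  simp only [kuhnVertex, h1, h2, Fin.ext_iff]
  by_cases h : p = Fin.last n
  · rw [if_pos h] at h3
    have : ¬ (p : ℕ) < k := by simp [h]; omega
    simp [h3, this]
  · rw [if_neg h] at h3
    have h4 : ((p : ℕ) < k) = ((p : ℕ) + 1 < k + 1) := by simp
    simp only [h3, h4, Fin.val_zero, Nat.succ_ne_zero, if_false, add_zero]

theorem mem_of_le_of_mem_of_succ_closed {m : ℕ} {t : Finset (Fin m)}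
    (h : ∀ a b : Fin m, (b : ℕ) = a + 1 → b ∈ t → a ∈ t) {i j : Fin m} (hij : i ≤ j)
    (hj : j ∈ t) : i ∈ t := by
  obtain ⟨i, hi⟩ := i
  obtain ⟨j, hj'⟩ := j
  replace hij : i ≤ j := hij
  induction j, hij using Nat.le_induction with
  | base => exact hj
  | succ k hk ih => exact ih (by omega) (h ⟨k, by omega⟩ ⟨k + 1, hj'⟩ rfl hj)

/-- Vertex `k` is read only by the factor `k` (if `k ∉ t`) or `k - 1` (if `k - 1 ∈ t`). If `t`
contains `a + 1` but not `a`, vertex `a + 1` is never read, and exchanging the steps `a` and `a + 1`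
pairs off equal terms. Otherwise `t` is a proper nonempty initial segment, neither end vertex is
read, and `kuhnEndSwap` does the pairing. -/
theorem finsum_kuhnMonomial_sub {n : ℕ} (φ ψ : Fin (n + 1) → (Fin (n + 1) → ℤ) → ZMod 2)
    (t : Finset (Fin (n + 1))) (ht : t ≠ ∅) (ht' : t ≠ Finset.univ)
    (hfin : (fun S => kuhnMonomial φ t S - kuhnMonomial ψ t S).support.Finite) :
    ∑ᶠ S, (kuhnMonomial φ t S - kuhnMonomial ψ t S) = 0 := by
  by_cases hasc : ∃ a b : Fin (n + 1), (b : ℕ) = a + 1 ∧ b ∈ t ∧ a ∉ t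
  · obtain ⟨a, b, hab, hb, ha⟩ := hasc
    have hne : a ≠ b := fun h => ha (h ▸ hb)
    have key : ∀ (χ : Fin (n + 1) → (Fin (n + 1) → ℤ) → ZMod 2) S,
        kuhnMonomial χ t (kuhnSwap a b S) = kuhnMonomial χ t S := by
      intro χ S
      refine Finset.prod_congr rfl fun j _ => ?_
      rw [kuhnVertex_kuhnSwap hab]
      split_ifs with hj
      · intro h
        exact ha (by rwa [show a = j from Fin.ext (by omega)])
      · intro h
        exact hj (by rwa [show j = b from Fin.ext h])
    refine finsum_eq_zero_of_involution _ hfin (kuhnSwap a b) ?_ ?_ ?_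
    · intro S
      refine Prod.ext rfl (Equiv.ext fun i => ?_)
      simp [kuhnSwap]
    · intro S h
      exact kuhnSwap_snd_ne hne S.2 (congrArg Prod.snd h)
    · intro S
      simp only [key]
  · push Not at hasc
    have h0 : (0 : Fin (n + 1)) ∈ t := by
      obtain ⟨j, hj⟩ := Finset.nonempty_iff_ne_empty.2 ht
      exact mem_of_le_of_mem_of_succ_closed hasc (Fin.zero_le j) hj
    have hl : Fin.last n ∉ t := fun h =>
      ht' (Finset.eq_univ_iff_forall.2 fun i => mem_of_le_of_mem_of_succ_closed hasc (Fin.le_last i) h)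
    have hne : (0 : Fin (n + 1)) ≠ Fin.last n := fun h => hl (h ▸ h0)
    have key : ∀ (χ : Fin (n + 1) → (Fin (n + 1) → ℤ) → ZMod 2) S,
        kuhnMonomial χ t (kuhnEndSwap 0 (Fin.last n) S) = kuhnMonomial χ t S := by
      intro χ S
      refine Finset.prod_congr rfl fun j _ => ?_
      rw [kuhnVertex_kuhnEndSwap rfl (by simp)]
      · split_ifs with hj
        · omega
        · exact Nat.pos_of_ne_zero fun h => hj (by rwa [show j = 0 from Fin.ext h])
      · split_ifs with hj
        · have : (j : ℕ) ≠ n := fun h => hl (by rwa [show Fin.last n = j from Fin.ext h.symm])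
          omega
        · exact j.2
    refine finsum_eq_zero_of_involution _ hfin (kuhnEndSwap 0 (Fin.last n))
      (kuhnEndSwap_kuhnEndSwap hne) ?_ ?_
    · intro S h
      exact kuhnSwap_snd_ne hne S.2 (congrArg Prod.snd h)
    · intro S
      simp only [key]

/-- A nonzero term needs a vertex in `K`, and a simplex is determined by its permutation and any one
of its vertices. -/
theorem finite_support_kuhnMonomial_sub {m : ℕ} (φ ψ : Fin m → (Fin m → ℤ) → ZMod 2)
    (K : Set (Fin m → ℤ)) (hK : K.Finite) (h : ∀ j, ∀ z ∉ K, φ j z = ψ j z)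
    (t : Finset (Fin m)) :
    (fun S => kuhnMonomial φ t S - kuhnMonomial ψ t S).support.Finite := by
  have hfin : (⋃ k ∈ Finset.range (m + 1),
      {S : (Fin m → ℤ) × Equiv.Perm (Fin m) | kuhnVertex S k ∈ K}).Finite := by
    refine Set.Finite.biUnion (Finset.finite_toSet _) fun k _ => ?_
    refine Set.Finite.of_finite_image (f := fun S => (kuhnVertex S k, S.2))
      ((hK.prod Set.finite_univ).subset ?_) ?_
    · rintro _ ⟨S, hS, rfl⟩
      exact ⟨hS, trivial⟩
    · rintro S _ S' _ hSS
      obtain ⟨h1, h2⟩ := Prod.ext_iff.1 hSS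
      refine Prod.ext ?_ h2
      funext i
      have := congrFun h1 i
      simp only [kuhnVertex] at this h2
      rw [h2] at this
      exact add_right_cancel this
  refine hfin.subset fun S hS => ?_
  by_contra hcon
  simp only [Set.mem_iUnion, Finset.mem_range, Set.mem_ofPred_eq, not_exists] at hcon
  refine hS (sub_eq_zero.2 (Finset.prod_congr rfl fun j _ => h j _ (hcon _ ?_)))
  split_ifs <;> omega

/-- After expansion into monomials, only `∅` and `univ` escape the pairing. They read vertices `0,
…, n` and `1, …, n + 1`, so `kuhnRotate` identifies their totals, which cancel mod 2. Differences
are summed because a single cup product may have infinite support. -/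
theorem finsum_kuhnCup_sub {n : ℕ} (φ ψ : Fin (n + 1) → (Fin (n + 1) → ℤ) → ZMod 2)
    (K : Set (Fin (n + 1) → ℤ)) (hK : K.Finite) (h : ∀ j, ∀ z ∉ K, φ j z = ψ j z) :
    ∑ᶠ S, (kuhnCup φ S - kuhnCup ψ S) = 0 := by
  classical
  have hfin := finite_support_kuhnMonomial_sub φ ψ K hK h
  have hrot : ∑ᶠ S, (kuhnMonomial φ Finset.univ S - kuhnMonomial ψ Finset.univ S) =
      ∑ᶠ S, (kuhnMonomial φ ∅ S - kuhnMonomial ψ ∅ S) := by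
    rw [← finsum_comp_equiv (kuhnRotate (n := n)) (f := fun S =>
      kuhnMonomial φ ∅ S - kuhnMonomial ψ ∅ S)]
    refine finsum_congr fun S => ?_
    simp only [kuhnMonomial, Finset.mem_univ, if_true, Finset.notMem_empty, if_false]
    congr 1 <;> exact Finset.prod_congr rfl fun j _ => by rw [kuhnVertex_kuhnRotate S j.2]
  simp only [kuhnCup_eq_sum, ← Finset.sum_sub_distrib]
  rw [finsum_sum_comm _ _ fun t _ => hfin t,
    ← Finset.sum_subset (Finset.subset_univ {∅, Finset.univ}),
    Finset.sum_pair Finset.univ_nonempty.ne_empty.symm, hrot]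
  · exact CharTwo.add_self_eq_zero _
  · intro t _ ht
    simp only [Finset.mem_insert, Finset.mem_singleton, not_or] at ht
    exact finsum_kuhnMonomial_sub φ ψ t ht.1 ht.2 (hfin t)

/-- A nonzero factor `j` means that coordinate `j` crosses from 0 to 1 between vertices `j` and `j +
1`, which fixes both its base value and its step. -/
theorem kuhnCup_coordinates {m : ℕ} (S : (Fin m → ℤ) × Equiv.Perm (Fin m)) :
    kuhnCup (fun j z => if 0 < z j then 1 else 0) S =
      if S = (0, Equiv.refl _) then 1 else 0 := by
  split_ifs with h
  · subst h
    exact Finset.prod_eq_one fun j _ => by simp [kuhnVertex]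
  · by_contra hcon
    rw [← Ne, kuhnCup, Finset.prod_ne_zero_iff] at hcon
    have key : ∀ j, S.1 j = 0 ∧ S.2 j = j := by
      intro j
      have hne := hcon j (Finset.mem_univ j)
      have hv : (0 < kuhnVertex S (j + 1) j ∧ ¬ 0 < kuhnVertex S j j) ∨
          (¬ 0 < kuhnVertex S (j + 1) j ∧ 0 < kuhnVertex S j j) := by
        by_contra hv
        refine hne ?_
        have : 0 < kuhnVertex S (j + 1) j ↔ 0 < kuhnVertex S j j := by tauto
        simp only [this]
        exact CharTwo.add_self_eq_zero _
      rw [Fin.ext_iff]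
      simp only [kuhnVertex] at hv
      split_ifs at hv <;> omega
    exact h (Prod.ext (funext fun j => (key j).1) (Equiv.ext fun j => (key j).2))

/-! ### From the parity count to the Poincaré–Miranda theorem -/

/-- If the `P j` agree with the coordinate half-spaces off a finite set, then some Kuhn simplex has,
for every `j`, a point where `P j` holds and one where it does not, among its `j`-th and
`(j + 1)`-st vertices. -/
theorem exists_kuhn_simplex_of_agree {m : ℕ} (P : Fin m → (Fin m → ℤ) → Prop)
    (K : Set (Fin m → ℤ)) (hK : K.Finite) (h : ∀ j, ∀ z ∉ K, (P j z ↔ 0 < z j)) :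
    ∃ S : (Fin m → ℤ) × Equiv.Perm (Fin m),
      ∀ j : Fin m, ¬ (P j (kuhnVertex S (j + 1)) ↔ P j (kuhnVertex S j)) := by
  classical
  rcases m with _ | n
  · exact ⟨(0, Equiv.refl _), fun j => j.elim0⟩
  set φ : Fin (n + 1) → (Fin (n + 1) → ℤ) → ZMod 2 := fun j z => if P j z then 1 else 0 with hφ
  suffices ∃ S, kuhnCup φ S ≠ 0 by
    obtain ⟨S, hS⟩ := this
    refine ⟨S, fun j hj => ?_⟩
    refine Finset.prod_ne_zero_iff.1 hS j (Finset.mem_univ j) ?_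
    simp only [hφ, hj]
    exact CharTwo.add_self_eq_zero _
  by_contra! hcon
  have := finsum_kuhnCup_sub φ (fun j z => if 0 < z j then 1 else 0) K hK
    fun j z hz => by simp only [hφ, h j z hz]
  simp only [hcon, kuhnCup_coordinates] at this
  -- With every cup product of `φ` zero, the total is minus the contribution of the one reference
  -- simplex, a unit of `ZMod 2`.
  rw [finsum_eq_single _ (0, Equiv.refl _) fun S hS => by rw [if_neg hS, sub_zero]] at this
  simp at this

/-- A discrete Poincaré–Miranda theorem on the integer points of the cube `[-N, N]^m`. -/
theorem exists_cube_of_boundary {m : ℕ} {N : ℤ} (hN : 0 < N) (P : Fin m → (Fin m → ℤ) → Prop)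
    (hpos : ∀ j z, (∀ i, |z i| ≤ N) → z j = N → P j z)
    (hneg : ∀ j z, (∀ i, |z i| ≤ N) → z j = -N → ¬ P j z) :
    ∃ x : Fin m → ℤ, (∀ i, |x i| ≤ N) ∧ ∀ j, ∃ p q : Fin m → ℤ,
      (∀ i, |p i| ≤ N ∧ |p i - x i| ≤ 1) ∧ (∀ i, |q i| ≤ N ∧ |q i - x i| ≤ 1) ∧
        P j p ∧ ¬ P j q := by
  have hK : {z : Fin m → ℤ | ∀ i, |z i| ≤ N}.Finite :=
    (Set.finite_Icc (fun _ : Fin m => -N) fun _ => N).subset fun z hz =>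
      ⟨fun i => (abs_le.1 (hz i)).1, fun i => (abs_le.1 (hz i)).2⟩
  -- Outside the cube `P` is replaced by the coordinate half-spaces, so that the two families differ
  -- only on a finite set.
  obtain ⟨S, hS⟩ := exists_kuhn_simplex_of_agree
    (fun j z => ((∀ i, |z i| ≤ N) ∧ P j z) ∨ ((¬ ∀ i, |z i| ≤ N) ∧ 0 < z j)) _ hK
    fun j z hz => by
      have : ¬ ∀ i, |z i| ≤ N := hz
      tauto
  have hv : ∀ k i, S.1 i ≤ kuhnVertex S k i ∧ kuhnVertex S k i ≤ S.1 i + 1 := by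
    intro k i
    simp only [kuhnVertex]
    split_ifs <;> omega
  have hbox : ∀ k i, |kuhnVertex S k i| ≤ N := by
    intro k i
    by_contra hcon
    refine hS i ?_
    rw [abs_le, not_and_or, not_le, not_le] at hcon
    have hk := hv k i
    -- If coordinate `i` of one vertex leaves the cube, coordinate `i` of every vertex is at most
    -- `-N`, or every one is at least `N`; the extended predicate `i` is then constant on the
    -- simplex.
    rcases hcon with h | h
    · have hfalse : ∀ k', ¬ (((∀ i, |kuhnVertex S k' i| ≤ N) ∧ P i (kuhnVertex S k')) ∨
          ((¬ ∀ i, |kuhnVertex S k' i| ≤ N) ∧ 0 < kuhnVertex S k' i)) := by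
        intro k'
        have hk' := hv k' i
        rintro (⟨hb, hP⟩ | ⟨-, h0⟩)
        · have := (abs_le.1 (hb i)).1
          exact hneg i _ hb (by omega) hP
        · omega
      simp only [hfalse]
    · have htrue : ∀ k', (((∀ i, |kuhnVertex S k' i| ≤ N) ∧ P i (kuhnVertex S k')) ∨
          ((¬ ∀ i, |kuhnVertex S k' i| ≤ N) ∧ 0 < kuhnVertex S k' i)) := by
        intro k'
        have hk' := hv k' i
        by_cases hb : ∀ i, |kuhnVertex S k' i| ≤ N
        · have := (abs_le.1 (hb i)).2
          exact Or.inl ⟨hb, hpos i _ hb (by omega)⟩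
        · exact Or.inr ⟨hb, by omega⟩
      simp only [htrue]
  have hx : kuhnVertex S 0 = S.1 := by
    funext i
    simp [kuhnVertex]
  refine ⟨S.1, hx ▸ hbox 0, fun j => ?_⟩
  have hnear : ∀ k i, |kuhnVertex S k i| ≤ N ∧ |kuhnVertex S k i - S.1 i| ≤ 1 := fun k i =>
    ⟨hbox k i, abs_le.2 ⟨by linarith [hv k i], by linarith [hv k i]⟩⟩
  have := hS j
  simp only [hbox, implies_true, true_and, not_true, false_and, or_false] at this
  by_cases h : P j (kuhnVertex S j)
  · exact ⟨kuhnVertex S j, kuhnVertex S (j + 1), hnear _, hnear _, h,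
      fun h' => this ⟨fun _ => h, fun _ => h'⟩⟩
  · exact ⟨kuhnVertex S (j + 1), kuhnVertex S j, hnear _, hnear _,
      by_contra fun h' => this ⟨fun a => absurd a h', fun a => absurd a h⟩, h⟩

/-- The Poincaré–Miranda theorem. -/
theorem poincare_miranda {m : ℕ} {r : ℝ} (hr : 0 < r) (F : (Fin m → ℝ) → Fin m → ℝ)
    (hF : ContinuousOn F (Metric.closedBall 0 r))
    (hpos : ∀ i, ∀ x ∈ Metric.closedBall (0 : Fin m → ℝ) r, x i = r → 0 < F x i)
    (hneg : ∀ i, ∀ x ∈ Metric.closedBall (0 : Fin m → ℝ) r, x i = -r → F x i < 0) :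
    ∃ x ∈ Metric.closedBall (0 : Fin m → ℝ) r, F x = 0 := by
  rcases m.eq_zero_or_pos with rfl | -
  · exact ⟨0, by simp [hr.le], Subsingleton.elim _ _⟩
  have hcomp : IsCompact (Metric.closedBall (0 : Fin m → ℝ) r) := isCompact_closedBall 0 r
  -- If there is no zero, the minimum of `‖F‖` is positive and serves as tolerance for uniform
  -- continuity; the mesh `r / N` is chosen below the resulting `η`.
  obtain ⟨y, hy, hmin⟩ := hcomp.exists_isMinOn ⟨0, by simp [hr.le]⟩ hF.norm
  by_contra! hcon
  have hδ : 0 < ‖F y‖ := norm_pos_iff.2 (hcon y hy)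
  obtain ⟨η, hη, hunif⟩ := Metric.uniformContinuousOn_iff.1
    (hcomp.uniformContinuousOn_of_continuous hF) _ hδ
  obtain ⟨N, hN⟩ := exists_nat_gt (r / η)
  have hN0 : (0 : ℝ) < N := (div_pos hr hη).trans hN
  have hrN : r / N < η := by
    rw [div_lt_iff₀ hη] at hN
    rw [div_lt_iff₀ hN0]
    linarith
  set s : (Fin m → ℤ) → Fin m → ℝ := fun z i => r / N * z i with hs
  have hsball : ∀ z : Fin m → ℤ, (∀ i, |z i| ≤ (N : ℤ)) →
      s z ∈ Metric.closedBall (0 : Fin m → ℝ) r := by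
    intro z hz
    rw [mem_closedBall_zero_iff, pi_norm_le_iff_of_nonneg hr.le]
    intro i
    have h1 : |(z i : ℝ)| ≤ N := by exact_mod_cast hz i
    rw [Real.norm_eq_abs, hs, abs_mul, abs_of_pos (by positivity)]
    calc r / N * |(z i : ℝ)| ≤ r / N * N := by gcongr
      _ = r := by field_simp
  have hsdist : ∀ z x : Fin m → ℤ, (∀ i, |z i - x i| ≤ 1) → dist (s z) (s x) < η := by
    intro z x hz
    refine lt_of_le_of_lt ((dist_pi_le_iff (by positivity)).2 fun i => ?_) hrN
    have h1 : |(z i : ℝ) - x i| ≤ 1 := by exact_mod_cast hz i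
    rw [Real.dist_eq, hs, ← mul_sub, abs_mul, abs_of_pos (by positivity)]
    exact mul_le_of_le_one_right (by positivity) h1
  obtain ⟨x, hx, hpq⟩ := exists_cube_of_boundary (N := N) (by exact_mod_cast hN0)
    (fun j z => 0 < F (s z) j)
    (fun j z hz hj => hpos j _ (hsball z hz) (by simp only [hs, hj, Int.cast_natCast]; field_simp))
    (fun j z hz hj => (hneg j _ (hsball z hz)
      (by simp only [hs, hj, Int.cast_neg, Int.cast_natCast]; field_simp)).not_gt)
  -- Each `F · j` is positive at one point near `s x` and nonpositive at another, so `|F (s x) j|`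
  -- is below the minimum norm.
  refine lt_irrefl ‖F y‖ (lt_of_le_of_lt (hmin (hsball x hx)) ?_)
  rw [pi_norm_lt_iff hδ]
  intro j
  obtain ⟨p, q, hp, hq, hFp, hFq⟩ := hpq j
  have h1 := hunif _ (hsball p fun i => (hp i).1) _ (hsball x hx) (hsdist p x fun i => (hp i).2)
  have h2 := hunif _ (hsball q fun i => (hq i).1) _ (hsball x hx) (hsdist q x fun i => (hq i).2)
  replace h1 := (dist_le_pi_dist _ _ j).trans_lt h1
  replace h2 := (dist_le_pi_dist _ _ j).trans_lt h2
  rw [Real.dist_eq, abs_lt] at h1 h2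
  rw [Real.norm_eq_abs, abs_lt]
  constructor <;> linarith

variable {X : Type*} [NormedAddCommGroup X] [NormedSpace ℝ X]

/-! ### Weak* compactness and separation -/

/-- For convex sets the hull of the union consists of segments joining them, hence is a continuous
image of `[0, 1] × s × t`. -/
theorem isCompact_convexHull_union {E : Type*} [AddCommGroup E] [Module ℝ E] [TopologicalSpace E]
    [ContinuousAdd E] [ContinuousSMul ℝ E] {s t : Set E} (hs : Convex ℝ s) (ht : Convex ℝ t)
    (hsc : IsCompact s) (htc : IsCompact t) : IsCompact (convexHull ℝ (s ∪ t)) := by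
  rcases s.eq_empty_or_nonempty with rfl | hs0
  · rwa [empty_union, ht.convexHull_eq]
  rcases t.eq_empty_or_nonempty with rfl | ht0
  · rwa [union_empty, hs.convexHull_eq]
  have : convexHull ℝ (s ∪ t) = (fun p : ℝ × E × E => (1 - p.1) • p.2.1 + p.1 • p.2.2) ''
      (Icc (0 : ℝ) 1 ×ˢ s ×ˢ t) := by
    rw [hs.convexHull_union ht hs0 ht0]
    ext z
    simp only [mem_convexJoin, segment_eq_image, mem_image, mem_prod, Prod.exists]
    constructor
    · rintro ⟨a, ha, b, hb, θ, hθ, rfl⟩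
      exact ⟨θ, a, b, ⟨hθ, ha, hb⟩, rfl⟩
    · rintro ⟨θ, a, b, ⟨hθ, ha, hb⟩, rfl⟩
      exact ⟨a, ha, b, hb, θ, hθ, rfl⟩
  rw [this]
  exact (isCompact_Icc.prod (hsc.prod htc)).image (by fun_prop)

theorem isCompact_convexHull_biUnion {E ι : Type*} [AddCommGroup E] [Module ℝ E]
    [TopologicalSpace E] [ContinuousAdd E] [ContinuousSMul ℝ E] {I : Set ι} (hI : I.Finite)
    {C : ι → Set E} (hC : ∀ i ∈ I, Convex ℝ (C i)) (hCc : ∀ i ∈ I, IsCompact (C i)) :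
    IsCompact (convexHull ℝ (⋃ i ∈ I, C i)) := by
  induction I, hI using Set.Finite.induction_on with
  | empty => simp
  | @insert a s _ _ ih =>
    rw [biUnion_insert, ← convexHull_convexHull_union_right]
    exact isCompact_convexHull_union (hC _ (mem_insert _ _)) (convex_convexHull ℝ _)
      (hCc _ (mem_insert _ _))
      (ih (fun i hi => hC i (mem_insert_of_mem _ hi)) fun i hi => hCc i (mem_insert_of_mem _ hi))

/-- A weak* compact convex set that does not meet the weak* closure of a subspace is separated from
it by a vector. -/
theorem exists_vector_of_disjoint_closure {C : Set (WeakDual ℝ X)} (hC : Convex ℝ C)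
    (hCc : IsCompact C) (N : Submodule ℝ (WeakDual ℝ X))
    (hd : C ∩ closure (N : Set (WeakDual ℝ X)) = ∅) :
    ∃ u : X, (∀ a ∈ C, 0 < a u) ∧ ∀ a ∈ N, a u = 0 := by
  have : LocallyConvexSpace ℝ (WeakDual ℝ X) :=
    inferInstanceAs (LocallyConvexSpace ℝ (WeakBilin (topDualPairing ℝ X)))
  have : IsTopologicalAddGroup (WeakDual ℝ X) :=
    inferInstanceAs (IsTopologicalAddGroup (WeakBilin (topDualPairing ℝ X)))
  obtain ⟨F, p, q, hp, hpq, hq⟩ := geometric_hahn_banach_compact_closed hC hCc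
    N.convex.closure isClosed_closure (disjoint_iff_inter_eq_empty.2 hd)
  -- Weak* continuous functionals on the dual are evaluations at vectors.
  obtain ⟨u, hu⟩ := LinearMap.dualEmbedding_surjective (topDualPairing ℝ X) F
  have hF : ∀ a : WeakDual ℝ X, F a = a u := fun a => by rw [← hu]; rfl
  have hqN : ∀ a ∈ N, q < a u := fun a ha => hF a ▸ hq a (subset_closure ha)
  have hq0 : q < 0 := hqN 0 N.zero_mem
  refine ⟨-u, fun a ha => ?_, fun a ha => ?_⟩
  · have := hp a ha
    rw [hF] at this
    rw [map_neg]
    linarith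
  · rw [map_neg, neg_eq_zero]
    -- A functional bounded below on a subspace vanishes there: otherwise rescaling `a` attains the
    -- value `q`, a strict lower bound.
    by_contra h0
    have := hqN _ (N.smul_mem (q / a u) ha)
    change q < q / a u * a u at this
    rw [div_mul_cancel₀ _ h0] at this
    exact lt_irrefl _ this

/-! ### Increments of directional derivatives -/

theorem IsQuasidifferentialAt.convex_quasidiffSum {f : X → ℝ} {x : X} {A B : Set (WeakDual ℝ X)}
    (h : IsQuasidifferentialAt f x A B) : Convex ℝ (quasidiffSum A B) :=
  h.convex_sub.add h.convex_super

theorem IsQuasidifferentialAt.isCompact_quasidiffSum {f : X → ℝ} {x : X}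
    {A B : Set (WeakDual ℝ X)} (h : IsQuasidifferentialAt f x A B) :
    IsCompact (quasidiffSum A B) :=
  h.isCompact_sub.add h.isCompact_super

/-- Take `a` attaining the maximum at `w` and `b` attaining the minimum at `w + u`: then `a + b`
bounds the derivative from above at `w` and from below at `w + u`. -/
theorem IsQuasidifferentialAt.exists_dirDeriv_add_le {f : X → ℝ} {x : X}
    {A B : Set (WeakDual ℝ X)} (h : IsQuasidifferentialAt f x A B) (w u : X) :
    ∃ c ∈ quasidiffSum A B, dirDeriv f x w + c u ≤ dirDeriv f x (w + u) := by
  obtain ⟨s, t, ⟨⟨a, ha, rfl⟩, -⟩, ⟨-, ht⟩, h1⟩ := h.dirDeriv_eq w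
  obtain ⟨s', t', ⟨-, hs'⟩, ⟨⟨b, hb, rfl⟩, -⟩, h2⟩ := h.dirDeriv_eq (w + u)
  refine ⟨a + b, add_mem_add ha hb, ?_⟩
  have h3 := hs' (mem_image_of_mem _ ha)
  have h4 := ht (mem_image_of_mem _ hb)
  simp only [map_add] at h2 h3 h4
  change dirDeriv f x w + (a u + b u) ≤ _
  rw [h1, h2]
  linarith

theorem IsQuasidifferentialAt.dirDeriv_lt_add {f : X → ℝ} {x : X} {A B : Set (WeakDual ℝ X)}
    (h : IsQuasidifferentialAt f x A B) {u : X} (hu : ∀ c ∈ quasidiffSum A B, 0 < c u) (w : X) :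
    dirDeriv f x w < dirDeriv f x (w + u) := by
  obtain ⟨c, hc, hle⟩ := h.exists_dirDeriv_add_le w u
  linarith [hu c hc]

theorem IsQuasidifferentialAt.dirDeriv_add_lt {f : X → ℝ} {x : X} {A B : Set (WeakDual ℝ X)}
    (h : IsQuasidifferentialAt f x A B) {u : X} (hu : ∀ c ∈ quasidiffSum A B, c u < 0) (w : X) :
    dirDeriv f x (w + u) < dirDeriv f x w := by
  have := h.dirDeriv_lt_add (u := -u) (fun c hc => by simpa using hu c hc) (w + u)
  rwa [add_neg_cancel_right] at this

theorem IsQuasidifferentialAt.dirDeriv_add_eq {f : X → ℝ} {x : X} {A B : Set (WeakDual ℝ X)}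
    (h : IsQuasidifferentialAt f x A B) {u : X} (hu : ∀ c ∈ quasidiffSum A B, c u = 0) (w : X) :
    dirDeriv f x (w + u) = dirDeriv f x w := by
  obtain ⟨c, hc, hle⟩ := h.exists_dirDeriv_add_le w u
  obtain ⟨c', hc', hle'⟩ := h.exists_dirDeriv_add_le (w + u) (-u)
  rw [add_neg_cancel_right, map_neg, hu c' hc'] at hle'
  rw [hu c hc] at hle
  linarith

/-! ### Hadamard differentiability and the contingent cone -/

theorem IsDirDiffAt.tendsto_dirDeriv {f : X → ℝ} {x : X} (h : IsDirDiffAt f x) (v : X) :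
    Tendsto (fun α : ℝ => (f (x + α • v) - f x) / α) (𝓝[>] 0) (𝓝 (dirDeriv f x v)) :=
  tendsto_nhds_limUnder (h v)

theorem IsHadamardDirDiffAt.tendsto_dirDeriv {f : X → ℝ} {x : X} (h : IsHadamardDirDiffAt f x)
    (v : X) : Tendsto (fun p : ℝ × X => (f (x + p.1 • p.2) - f x) / p.1)
      (𝓝[>] (0 : ℝ) ×ˢ 𝓝 v) (𝓝 (dirDeriv f x v)) := by
  obtain ⟨d, hd⟩ := h v
  have h1 : Tendsto (fun α : ℝ => (α, v)) (𝓝[>] (0 : ℝ)) (𝓝[>] (0 : ℝ) ×ˢ 𝓝 v) :=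
    tendsto_id.prodMk tendsto_const_nhds
  have h2 : dirDeriv f x v = d := (hd.comp h1).limUnder_eq
  rwa [h2]

theorem tendsto_add_smul (x v : X) :
    Tendsto (fun p : ℝ × X => x + p.1 • p.2) (𝓝[>] (0 : ℝ) ×ˢ 𝓝 v) (𝓝 x) := by
  have h : Tendsto (fun p : ℝ × X => x + p.1 • p.2) (𝓝 ((0 : ℝ), v)) (𝓝 (x + (0 : ℝ) • v)) :=
    Continuous.tendsto (f := fun p : ℝ × X => x + p.1 • p.2) (by fun_prop) _
  rw [zero_smul, add_zero, nhds_prod_eq] at h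
  exact h.mono_left (prod_mono nhdsWithin_le_nhds le_rfl)

/-- The quotients along `v` and `v'` differ by at most `K * dist v v'`. -/
theorem IsDirDiffAt.isHadamardDirDiffAt {f : X → ℝ} {x : X} (h : IsDirDiffAt f x)
    (hL : IsLipschitzNear f x) : IsHadamardDirDiffAt f x := by
  obtain ⟨K, U, hU, hK⟩ := hL
  intro v
  have hd : Tendsto (fun p : ℝ × X => (f (x + p.1 • v) - f x) / p.1) (𝓝[>] (0 : ℝ) ×ˢ 𝓝 v)
      (𝓝 (dirDeriv f x v)) := (h.tendsto_dirDeriv v).comp tendsto_fst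
  refine ⟨dirDeriv f x v, hd.congr_dist ?_⟩
  have hv : Tendsto (fun p : ℝ × X => K * dist v p.2) (𝓝[>] (0 : ℝ) ×ˢ 𝓝 v) (𝓝 0) := by
    have : Tendsto (fun p : ℝ × X => K * dist v p.2) (𝓝[>] (0 : ℝ) ×ˢ 𝓝 v)
        (𝓝 (K * dist v v)) := (tendsto_const_nhds.dist tendsto_snd).const_mul _
    simpa using this
  refine squeeze_zero' (Eventually.of_forall fun p => dist_nonneg) ?_ hv
  have h1 : ∀ᶠ p : ℝ × X in 𝓝[>] (0 : ℝ) ×ˢ 𝓝 v, x + p.1 • p.2 ∈ U :=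
    (tendsto_add_smul x v).eventually hU
  have h2 : ∀ᶠ p : ℝ × X in 𝓝[>] (0 : ℝ) ×ˢ 𝓝 v, x + p.1 • v ∈ U :=
    ((tendsto_add_smul x v).comp (tendsto_fst.prodMk tendsto_const_nhds)).eventually hU
  have h3 : ∀ᶠ p : ℝ × X in 𝓝[>] (0 : ℝ) ×ˢ 𝓝 v, 0 < p.1 :=
    tendsto_fst.eventually self_mem_nhdsWithin
  filter_upwards [h1, h2, h3] with p hp1 hp2 hp3
  have := hK.dist_le_mul _ hp2 _ hp1
  rw [dist_add_left, dist_smul₀, Real.norm_eq_abs, abs_of_pos hp3] at this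
  rw [Real.dist_eq, ← sub_div, sub_sub_sub_cancel_right, abs_div, abs_of_pos hp3,
    div_le_iff₀ hp3, ← Real.dist_eq]
  linarith

theorem contingentCone_subset_linearizedSet {m l : ℕ} {f : Fin m → X → ℝ} {g : Fin l → X → ℝ}
    {x : X} (hx : x ∈ constraintSet f g) (hf : ∀ i, IsHadamardDirDiffAt (f i) x)
    (hg : ∀ j ∈ activeSet g x, IsHadamardDirDiffAt (g j) x) :
    contingentCone (constraintSet f g) x ⊆ linearizedSet f g x := by
  rintro v ⟨α, u, hα, hα0, hu, hM⟩
  have hαu : Tendsto (fun n => (α n, u n)) atTop (𝓝[>] (0 : ℝ) ×ˢ 𝓝 v) :=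
    (tendsto_nhdsWithin_iff.2 ⟨hα0, Eventually.of_forall hα⟩).prodMk hu
  refine ⟨fun i => ?_, fun j hj => ?_⟩
  · refine tendsto_nhds_unique (((hf i).tendsto_dirDeriv v).comp hαu)
      (tendsto_const_nhds.congr fun n => ?_)
    simp [(hM n).1 i, hx.1 i]
  · refine le_of_tendsto' (((hg j hj).tendsto_dirDeriv v).comp hαu) fun n => ?_
    have h0 : g j x = 0 := hj
    simp only [Function.comp_apply, h0, sub_zero]
    exact div_nonpos_of_nonpos_of_nonneg ((hM n).2 j) (hα n).le

theorem mem_contingentCone_of_forall {M : Set X} {x v : X}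
    (h : ∀ ε > 0, ∃ α : ℝ, 0 < α ∧ α < ε ∧ ∃ u, dist u v < ε ∧ x + α • u ∈ M) :
    v ∈ contingentCone M x := by
  choose α hα hαlt u hu hM using fun n : ℕ => h (1 / ((n : ℝ) + 1)) (by positivity)
  exact ⟨α, u, hα, squeeze_zero (fun n => (hα n).le) (fun n => (hαlt n).le)
    tendsto_one_div_add_atTop_nhds_zero_nat, tendsto_iff_dist_tendsto_zero.2
    (squeeze_zero (fun n => dist_nonneg) (fun n => (hu n).le)
      tendsto_one_div_add_atTop_nhds_zero_nat), hM⟩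

/-! ### Feasible points near a linearized direction -/

/-- The perturbations stay in the range of `L`, which is finite dimensional, so the restricted
uniformity suffices. -/
theorem IsDirDiffAtUnifFinDim.tendsto_comp_linear {E : Type*} [AddCommGroup E] [Module ℝ E]
    [TopologicalSpace E] [FiniteDimensional ℝ E] {f : X → ℝ} {x : X}
    (h : IsDirDiffAtUnifFinDim f x) (w : X) (L : E →L[ℝ] X) (t : E) :
    Tendsto (fun p : ℝ × E => (f (x + p.1 • (w + L p.2)) - f x) / p.1)
      (𝓝[>] (0 : ℝ) ×ˢ 𝓝 t) (𝓝 (dirDeriv f x (w + L t))) := by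
  have h1 := h.2 (w + L t) (L : E →ₗ[ℝ] X).range inferInstance
  have h2 : Tendsto (fun s : E => w + L s) (𝓝 t)
      (𝓝[{v' : X | v' - (w + L t) ∈ (L : E →ₗ[ℝ] X).range}] (w + L t)) := by
    refine tendsto_nhdsWithin_iff.2 ⟨Continuous.tendsto (by fun_prop) t,
      Eventually.of_forall fun s => ⟨s - t, ?_⟩⟩
    simp
  have h3 : Tendsto (fun p : ℝ × E => (p.1, w + L p.2)) (𝓝[>] (0 : ℝ) ×ˢ 𝓝 t)
      (𝓝[>] (0 : ℝ) ×ˢ 𝓝[{v' : X | v' - (w + L t) ∈ (L : E →ₗ[ℝ] X).range}] (w + L t)) :=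
    tendsto_fst.prodMk (h2.comp tendsto_snd)
  have h4 := h1.comp h3
  exact h4

theorem _root_.IsCompact.eventually_forall_of_prod {α Y : Type*} [TopologicalSpace Y]
    {l : Filter α} {K : Set Y} (hK : IsCompact K) {p : α → Y → Prop}
    (h : ∀ y ∈ K, ∀ᶠ z in l ×ˢ 𝓝 y, p z.1 z.2) : ∀ᶠ a in l, ∀ y ∈ K, p a y := by
  have : ∀ᶠ z in l ×ˢ 𝓝ˢ K, p z.1 z.2 := hK.mem_prod_nhdsSet_of_forall h
  exact this.curry.mono fun _ h => h.self_of_nhdsSet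

/-- If `L` moves the directional derivatives of the `f i` independently, then points of the
constraint set are found near `x + α • w`, for every direction `w` along which the active inequality
constraints strictly decrease. -/
theorem exists_mem_constraintSet {m l : ℕ} {f : Fin m → X → ℝ} {g : Fin l → X → ℝ} {x : X}
    (hx : x ∈ constraintSet f g) (hf_cont : ∀ i, ∃ U ∈ 𝓝 x, ContinuousOn (f i) U)
    (hg_usc : ∀ j, j ∉ activeSet g x → UpperSemicontinuousAt (g j) x)
    (hf : ∀ i, IsDirDiffAtUnifFinDim (f i) x)
    (hg : ∀ j ∈ activeSet g x, IsDirDiffAtUnifFinDim (g j) x)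
    (w : X) (L : (Fin m → ℝ) →L[ℝ] X)
    (hpos : ∀ i t, 0 < t i → 0 < dirDeriv (f i) x (w + L t))
    (hneg : ∀ i t, t i < 0 → dirDeriv (f i) x (w + L t) < 0)
    (hwg : ∀ j ∈ activeSet g x, dirDeriv (g j) x w < 0) {ε : ℝ} (hε : 0 < ε) :
    ∃ α : ℝ, 0 < α ∧ α < ε ∧ ∃ u, dist u w < ε ∧ x + α • u ∈ constraintSet f g := by
  have hpt : Tendsto (fun p : ℝ × (Fin m → ℝ) => x + p.1 • (w + L p.2))
      (𝓝[>] (0 : ℝ) ×ˢ 𝓝 0) (𝓝 x) := by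
    have h2 : Tendsto (fun s : Fin m → ℝ => w + L s) (𝓝 0) (𝓝 w) :=
      Continuous.tendsto' (by fun_prop) _ _ (by simp)
    exact (tendsto_add_smul x w).comp (tendsto_fst.prodMk (h2.comp tendsto_snd))
  have hcont : ∀ᶠ p : ℝ × (Fin m → ℝ) in 𝓝[>] (0 : ℝ) ×ˢ 𝓝 0,
      ∀ i, ContinuousAt (f i) (x + p.1 • (w + L p.2)) := by
    refine eventually_all.2 fun i => hpt.eventually ?_
    obtain ⟨U, hU, hc⟩ := hf_cont i
    filter_upwards [eventually_mem_nhds_iff.2 hU] with y hy using hc.continuousAt hy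
  have hgneg : ∀ᶠ p : ℝ × (Fin m → ℝ) in 𝓝[>] (0 : ℝ) ×ˢ 𝓝 0,
      ∀ j, g j (x + p.1 • (w + L p.2)) < 0 := by
    refine eventually_all.2 fun j => ?_
    by_cases hj : j ∈ activeSet g x
    · have h1 := (hg j hj).tendsto_comp_linear w L 0
      rw [map_zero, add_zero] at h1
      filter_upwards [h1.eventually_lt_const (hwg j hj),
        tendsto_fst.eventually (self_mem_nhdsWithin : Ioi (0 : ℝ) ∈ 𝓝[>] 0)] with p hp hp0
      have h0 : g j x = 0 := hj
      rw [h0, sub_zero] at hp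
      exact neg_of_div_neg_left hp (le_of_lt hp0)
    · exact hpt.eventually (hg_usc j hj 0 (lt_of_le_of_ne (hx.2 j) hj))
  have hdist : ∀ᶠ p : ℝ × (Fin m → ℝ) in 𝓝[>] (0 : ℝ) ×ˢ 𝓝 0, dist (w + L p.2) w < ε := by
    have h2 : Tendsto (fun s : Fin m → ℝ => dist (w + L s) w) (𝓝 0) (𝓝 0) :=
      Continuous.tendsto' (by fun_prop) _ _ (by simp)
    exact tendsto_snd.eventually (h2.eventually_lt_const hε)
  obtain ⟨pa, hpa, pb, hpb, hall⟩ :=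
    eventually_prod_iff.1 (hcont.and (hgneg.and hdist))
  obtain ⟨r, hr, hball⟩ := Metric.nhds_basis_closedBall.eventually_iff.1 hpb
  have hface : ∀ (i : Fin m) (c : ℝ),
      IsCompact (Metric.closedBall (0 : Fin m → ℝ) r ∩ {t | t i = c}) := fun i c =>
    (isCompact_closedBall _ _).inter_right (isClosed_eq (continuous_apply i) continuous_const)
  -- The sup-norm ball is a cube; compactness of its faces makes the sign of the limit valid on a
  -- whole face for one common `α`.
  have hup : ∀ᶠ α : ℝ in 𝓝[>] 0, ∀ i, ∀ t ∈ Metric.closedBall (0 : Fin m → ℝ) r ∩ {t | t i = r},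
      0 < (f i (x + α • (w + L t)) - f i x) / α := by
    refine eventually_all.2 fun i => (hface i r).eventually_forall_of_prod fun t ht => ?_
    exact ((hf i).tendsto_comp_linear w L t).eventually_const_lt
      (hpos i t (by rw [show t i = r from ht.2]; exact hr))
  have hlo : ∀ᶠ α : ℝ in 𝓝[>] 0, ∀ i, ∀ t ∈ Metric.closedBall (0 : Fin m → ℝ) r ∩ {t | t i = -r},
      (f i (x + α • (w + L t)) - f i x) / α < 0 := by
    refine eventually_all.2 fun i => (hface i (-r)).eventually_forall_of_prod fun t ht => ?_
    exact ((hf i).tendsto_comp_linear w L t).eventually_lt_const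
      (hneg i t (by rw [show t i = -r from ht.2]; linarith))
  have hα : ∀ᶠ α : ℝ in 𝓝[>] 0, 0 < α ∧ α < ε := Ioo_mem_nhdsGT hε
  obtain ⟨α, hαa, hαu, hαl, hα0, hαε⟩ := (hpa.and (hup.and (hlo.and hα))).exists
  obtain ⟨t, ht, hzero⟩ := poincare_miranda hr (fun t i => (f i (x + α • (w + L t)) - f i x) / α)
    (continuousOn_pi.2 fun i t ht => by
      have h1 := (hall hαa (hball ht)).1 i
      have h2 : ContinuousAt (fun t => x + α • (w + L t)) t := by fun_prop
      have h3 : ContinuousAt (fun t => f i (x + α • (w + L t))) t :=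
        ContinuousAt.comp (g := f i) (f := fun t => x + α • (w + L t)) h1 h2
      exact ((h3.sub continuousAt_const).div_const α).continuousWithinAt)
    (fun i t ht hti => hαu i t ⟨ht, hti⟩) fun i t ht hti => hαl i t ⟨ht, hti⟩
  obtain ⟨-, h2, h3⟩ := hall hαa (hball ht)
  refine ⟨α, hα0, hαε, w + L t, h3, fun i => ?_, fun j => (h2 j).le⟩
  have := congrFun hzero i
  simpa [hα0.ne', hx.1 i] using this

theorem linearizedSet_subset_contingentCone {m l : ℕ} {f : Fin m → X → ℝ} {g : Fin l → X → ℝ}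
    {x : X} (hx : x ∈ constraintSet f g)
    {subf supf : Fin m → Set (WeakDual ℝ X)} {subg supg : Fin l → Set (WeakDual ℝ X)}
    (hf_cont : ∀ i, ∃ U ∈ 𝓝 x, ContinuousOn (f i) U)
    (hg_usc : ∀ j, j ∉ activeSet g x → UpperSemicontinuousAt (g j) x)
    (hf_qd : ∀ i, IsQuasidifferentialAt (f i) x (subf i) (supf i))
    (hf_unif : ∀ i, IsDirDiffAtUnifFinDim (f i) x)
    (hg_qd : ∀ j ∈ activeSet g x, IsQuasidifferentialAt (g j) x (subg j) (supg j))
    (hg_unif : ∀ j ∈ activeSet g x, IsDirDiffAtUnifFinDim (g j) x)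
    (hLI : ∀ i, quasidiffSum (subf i) (supf i) ∩
      closure (Submodule.span ℝ (⋃ k ∈ {k : Fin m | k ≠ i}, quasidiffSum (subf k) (supf k)) :
        Set (WeakDual ℝ X)) = ∅)
    (hNI : convexHull ℝ (⋃ j ∈ activeSet g x, quasidiffSum (subg j) (supg j)) ∩
      closure (Submodule.span ℝ (⋃ i, quasidiffSum (subf i) (supf i)) :
        Set (WeakDual ℝ X)) = ∅) :
    linearizedSet f g x ⊆ contingentCone (constraintSet f g) x := by
  intro v hv
  choose V hVpos hVzero using fun i => exists_vector_of_disjoint_closure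
    (hf_qd i).convex_quasidiffSum (hf_qd i).isCompact_quasidiffSum _ (hLI i)
  obtain ⟨d, hdpos, hdzero⟩ := exists_vector_of_disjoint_closure (convex_convexHull ℝ _)
    (isCompact_convexHull_biUnion (Set.toFinite _) (fun j hj => (hg_qd j hj).convex_quasidiffSum)
      fun j hj => (hg_qd j hj).isCompact_quasidiffSum) _ hNI
  -- The `V i` act as a dual system: functionals of the i-th sum see only the coordinate `t i`, with
  -- a positive factor.
  set L : (Fin m → ℝ) →L[ℝ] X := (Fintype.linearCombination ℝ V).toContinuousLinearMap
  have hcL : ∀ i, ∀ c ∈ quasidiffSum (subf i) (supf i), ∀ t, c (L t) = t i * c (V i) := by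
    intro i c hc t
    have : L t = ∑ k, t k • V k := rfl
    rw [this, map_sum, Finset.sum_eq_single i]
    · rw [map_smul, smul_eq_mul]
    · intro k _ hk
      rw [map_smul, hVzero k c (Submodule.subset_span (mem_biUnion (x := i) hk.symm hc)), smul_zero]
    · simp
  refine mem_contingentCone_of_forall fun ε hε => ?_
  -- This gives `δ * ‖d‖ ≤ ε / 2`, leaving the other half of `ε` for the distance from `u` to the
  -- shifted direction.
  set δ := ε / (2 * (‖d‖ + 1)) with hδ
  have hδ0 : 0 < δ := by positivity
  have hwf : ∀ i, dirDeriv (f i) x (v + -(δ • d)) = 0 := fun i => by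
    rw [(hf_qd i).dirDeriv_add_eq, hv.1 i]
    intro c hc
    rw [map_neg, map_smul, hdzero c (Submodule.subset_span (mem_iUnion.2 ⟨i, hc⟩)), smul_zero,
      neg_zero]
  obtain ⟨α, hα0, hαε, u, hu, hM⟩ := exists_mem_constraintSet hx hf_cont hg_usc hf_unif hg_unif
    (v + -(δ • d)) L
    (fun i t ht => hwf i ▸ (hf_qd i).dirDeriv_lt_add (fun c hc => by
      rw [hcL i c hc]
      exact mul_pos ht (hVpos i c hc)) _)
    (fun i t ht => hwf i ▸ (hf_qd i).dirDeriv_add_lt (fun c hc => by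
      rw [hcL i c hc]
      exact mul_neg_of_neg_of_pos ht (hVpos i c hc)) _)
    (fun j hj => lt_of_lt_of_le ((hg_qd j hj).dirDeriv_add_lt (fun c hc => by
      rw [map_neg, map_smul, smul_eq_mul, neg_lt_zero]
      exact mul_pos hδ0 (hdpos c (subset_convexHull ℝ _ (mem_biUnion hj hc)))) _) (hv.2 j hj))
    (half_pos hε)
  refine ⟨α, hα0, by linarith, u, ?_, hM⟩
  have h1 : dist (v + -(δ • d)) v ≤ ε / 2 := by
    rw [dist_eq_norm, add_sub_cancel_left, norm_neg, norm_smul, Real.norm_of_nonneg hδ0.le, hδ,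
      div_mul_eq_mul_div, div_le_div_iff₀ (by positivity) two_pos]
    nlinarith [norm_nonneg d]
  linarith [dist_triangle u (v + -(δ • d)) v]

end Quasidiff

theorem mainTheorem5 {X : Type*} [NormedAddCommGroup X] [NormedSpace ℝ X] [CompleteSpace X]
    {m l : ℕ} (f : Fin m → X → ℝ) (g : Fin l → X → ℝ) (xbar : X)
    (hxbar : xbar ∈ Quasidiff.constraintSet f g)
    -- the given quasidifferentials `[subf i, supf i]` of `f i` and `[subg j, supg j]` of `g j`
    (subf supf : Fin m → Set (WeakDual ℝ X)) (subg supg : Fin l → Set (WeakDual ℝ X))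
    (hf_cont : ∀ i, ∃ U ∈ 𝓝 xbar, ContinuousOn (f i) U)
    (hg_usc : ∀ j, j ∉ Quasidiff.activeSet g xbar → UpperSemicontinuousAt (g j) xbar)
    (hf_qd : ∀ i, Quasidiff.IsQuasidifferentialAt (f i) xbar (subf i) (supf i))
    (hf_unif : ∀ i, Quasidiff.IsDirDiffAtUnifFinDim (f i) xbar)
    (hg_qd : ∀ j ∈ Quasidiff.activeSet g xbar,
      Quasidiff.IsQuasidifferentialAt (g j) xbar (subg j) (supg j))
    (hg_unif : ∀ j ∈ Quasidiff.activeSet g xbar, Quasidiff.IsDirDiffAtUnifFinDim (g j) xbar)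
    -- closures are taken in the weak* topology
    (hLI : ∀ i, Quasidiff.quasidiffSum (subf i) (supf i) ∩
      closure (Submodule.span ℝ
        (⋃ k ∈ {k : Fin m | k ≠ i}, Quasidiff.quasidiffSum (subf k) (supf k)) :
          Set (WeakDual ℝ X)) = ∅)
    (hNI : convexHull ℝ
        (⋃ j ∈ Quasidiff.activeSet g xbar, Quasidiff.quasidiffSum (subg j) (supg j)) ∩
      closure (Submodule.span ℝ
        (⋃ i, Quasidiff.quasidiffSum (subf i) (supf i)) : Set (WeakDual ℝ X)) = ∅) :
    Quasidiff.linearizedSet f g xbar ⊆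
        Quasidiff.contingentCone (Quasidiff.constraintSet f g) xbar ∧
    ((∀ i, Quasidiff.IsHadamardDirDiffAt (f i) xbar) →
      (∀ j ∈ Quasidiff.activeSet g xbar, Quasidiff.IsHadamardDirDiffAt (g j) xbar) →
      Quasidiff.linearizedSet f g xbar =
        Quasidiff.contingentCone (Quasidiff.constraintSet f g) xbar) ∧
    (∀ i, Quasidiff.IsLipschitzNear (f i) xbar → Quasidiff.IsHadamardDirDiffAt (f i) xbar) ∧
    (∀ j ∈ Quasidiff.activeSet g xbar,
      Quasidiff.IsLipschitzNear (g j) xbar → Quasidiff.IsHadamardDirDiffAt (g j) xbar) := by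
  have hsub := Quasidiff.linearizedSet_subset_contingentCone hxbar hf_cont hg_usc hf_qd hf_unif
    hg_qd hg_unif hLI hNI
  exact ⟨hsub,
    fun hf hg => hsub.antisymm (Quasidiff.contingentCone_subset_linearizedSet hxbar hf hg),
    fun i hL => (hf_qd i).isDirDiffAt.isHadamardDirDiffAt hL,
    fun j hj hL => (hg_qd j hj).isDirDiffAt.isHadamardDirDiffAt hL⟩
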